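/- For a permutation $\sigma=\sigma_1\sigma_2\cdots\sigma_n$ of $[n]=\{1,\dots,n\}$ let $$\mathrm{adj}(\sigma)=\#\{\,i : 1\le i\le n-1,\ \sigma_i=\sigma_{i+1}+1\,\}$$ be its number of adjacencies, i.e. the number of descents of the form $a+1,\,a$ at consecutive positions. Theorem. For each $n$ let $X_n=\mathrm{adj}(\sigma)$, where $\sigma$ is chosen uniformly at random from the $n!$ permutations of $[n]$. Then, as $n\to\infty$, $X_n$ converges in distribution to a Poisson random variable with mean $1$, i.e. to a random variable $Z$ with $\mathbb{P}(Z=k)=e^{-1}/k!$ for $k=0,1,2,\dots$. -/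

import Mathlib

open MeasureTheory ProbabilityTheory Filter

/-- The set of permutations of length `n` carries the discrete σ-algebra. -/
instance permMeasurableSpace (n : ℕ) : MeasurableSpace (Equiv.Perm (Fin n)) := ⊤

/-- The number of adjacencies of the permutation `σ = σ(0) σ(1) … σ(n-1)`: the number of positions
`i` such that `i + 1` is also a position and `σ(i) = σ(i+1) + 1`, i.e. `σ` has the descent
`a + 1, a` at the consecutive positions `i, i + 1`. (Positions and values are numbered from `0`
instead of `1`, which does not affect the count.) -/
def adj {n : ℕ} (σ : Equiv.Perm (Fin n)) : ℕ :=
  (Finset.univ.filter fun i : Fin n =>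
    ∃ h : (i : ℕ) + 1 < n, (σ i : ℕ) = (σ ⟨(i : ℕ) + 1, h⟩ : ℕ) + 1).card

/-!
The number of permutations of length `m + 1` with exactly `k` adjacencies is
`m.choose k * (D (m - k) + D (m - k + 1))`, where `D` counts derangements (`adjCount_eq`). Dividing
by `(m + 1)!` and using `D m / m! → e⁻¹`, the probability of `k` adjacencies tends to `e⁻¹ / k!`
(`tendsto_adjCount_div_factorial`), and on `ℕ` convergence of the point masses is weak convergence.

The formula comes from a recursion in the length. Every permutation of length `m + 2` arises
uniquely from one, `σ`, of length `m + 1` by appending a last entry `p` and raising the values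
`≥ p` by one. Write the candidates other than `p = m + 1` as `p = σ b` for a position `b`. If an
adjacency starts at `b`, it is destroyed; if `b` is the last position, a new adjacency is created;
and in all other cases the number of adjacencies does not change (`sum_adj_succ`). The derangement
numbers solve the resulting recursion because `D (m + 2) = (m + 1) * (D m + D (m + 1))`.
-/

/-! ### Appending an entry to a permutation -/

/-- The set of positions of the adjacencies of `σ`. -/
def adjSet {n : ℕ} (σ : Equiv.Perm (Fin n)) : Finset (Fin n) :=
  Finset.univ.filter fun i : Fin n =>
    ∃ h : (i : ℕ) + 1 < n, (σ i : ℕ) = (σ ⟨(i : ℕ) + 1, h⟩ : ℕ) + 1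

lemma card_adjSet {n : ℕ} (σ : Equiv.Perm (Fin n)) : (adjSet σ).card = adj σ := rfl

lemma last_notMem_adjSet {m : ℕ} (σ : Equiv.Perm (Fin (m + 1))) : Fin.last m ∉ adjSet σ := by
  simp [adjSet]

/-- The permutation of length `n + 1` whose last entry is `p` and whose remaining entries are in
the same relative order as those of `σ`: values of `σ` that are at least `p` are raised by one. -/
def snocPerm {n : ℕ} (p : Fin (n + 1)) (σ : Equiv.Perm (Fin n)) : Equiv.Perm (Fin (n + 1)) :=
  (finSuccEquivLast.trans (Equiv.optionCongr σ)).trans (finSuccEquiv' p).symm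

@[simp] lemma snocPerm_last {n : ℕ} (p : Fin (n + 1)) (σ : Equiv.Perm (Fin n)) :
    snocPerm p σ (Fin.last n) = p := by
  simp [snocPerm]

@[simp] lemma snocPerm_castSucc {n : ℕ} (p : Fin (n + 1)) (σ : Equiv.Perm (Fin n)) (i : Fin n) :
    snocPerm p σ i.castSucc = p.succAbove (σ i) := by
  simp [snocPerm]

lemma bijective_snocPerm (n : ℕ) :
    Function.Bijective fun x : Fin (n + 1) × Equiv.Perm (Fin n) => snocPerm x.1 x.2 := by
  rw [Fintype.bijective_iff_injective_and_card]
  refine ⟨?_, by simp [Fintype.card_perm, Nat.factorial_succ]⟩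
  rintro ⟨p, σ⟩ ⟨q, τ⟩ h
  have hpq : p = q := by simpa using DFunLike.congr_fun h (Fin.last n)
  subst hpq
  have hστ : σ = τ := Equiv.ext fun i => by simpa using DFunLike.congr_fun h i.castSucc
  rw [hστ]

/-- Appending the entry `p` destroys an adjacency `a + 1, a` exactly when `p` is the value
separating the two, that is, when `a + 1` becomes `a + 2` while `a` is kept. -/
lemma castSucc_mem_adjSet_snocPerm {m : ℕ} (p : Fin (m + 2)) (σ : Equiv.Perm (Fin (m + 1)))
    (i : Fin m) :
    i.castSucc.castSucc ∈ adjSet (snocPerm p σ) ↔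
      i.castSucc ∈ adjSet σ ∧ (σ i.castSucc).castSucc ≠ p := by
  have h1 : (⟨(i : ℕ) + 1, by lia⟩ : Fin (m + 2)) = i.succ.castSucc := by ext; simp
  have h2 : (⟨(i : ℕ) + 1, by lia⟩ : Fin (m + 1)) = i.succ := by ext; simp
  have hne : (σ i.castSucc : ℕ) ≠ σ i.succ := fun h =>
    (Fin.castSucc_lt_succ (i := i)).ne (σ.injective (Fin.ext h))
  have hi := i.isLt
  simp only [adjSet, Finset.mem_filter, Finset.mem_univ, true_and, Fin.val_castSucc, h1, h2,
    snocPerm_castSucc, Fin.succAbove, Fin.lt_def, ne_eq, Fin.ext_iff]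
  constructor
  · rintro ⟨_, h⟩
    refine ⟨⟨by lia, ?_⟩, ?_⟩ <;> split_ifs at h <;> simp at h <;> lia
  · rintro ⟨⟨_, h⟩, hp⟩
    refine ⟨by lia, ?_⟩
    split_ifs <;> simp <;> lia

/-- The appended entry `p` creates an adjacency exactly when `p + 1` is the new value of the
formerly last entry. -/
lemma castSucc_last_mem_adjSet_snocPerm {m : ℕ} (p : Fin (m + 2)) (σ : Equiv.Perm (Fin (m + 1))) :
    (Fin.last m).castSucc ∈ adjSet (snocPerm p σ) ↔ (σ (Fin.last m)).castSucc = p := by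
  have h1 : (⟨m + 1, by lia⟩ : Fin (m + 2)) = Fin.last (m + 1) := rfl
  simp only [adjSet, Finset.mem_filter, Finset.mem_univ, true_and, Fin.val_castSucc, Fin.val_last,
    h1, snocPerm_castSucc, snocPerm_last, Fin.succAbove, Fin.lt_def, Fin.ext_iff]
  constructor
  · rintro ⟨_, h⟩
    split_ifs at h <;> simp at h <;> lia
  · intro h
    refine ⟨by lia, ?_⟩
    split_ifs <;> simp <;> lia

lemma adjSet_snocPerm {m : ℕ} (p : Fin (m + 2)) (σ : Equiv.Perm (Fin (m + 1))) :
    adjSet (snocPerm p σ) =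
      ((adjSet σ).filter (fun a => (σ a).castSucc ≠ p) ∪
        Finset.univ.filter fun a => a = Fin.last m ∧ (σ a).castSucc = p).map Fin.castSuccEmb := by
  ext j
  induction j using Fin.lastCases with
  | last => simp [last_notMem_adjSet]
  | cast j =>
    have hmap (s : Finset (Fin (m + 1))) : j.castSucc ∈ s.map Fin.castSuccEmb ↔ j ∈ s :=
      Finset.mem_map' Fin.castSuccEmb
    rw [hmap]
    induction j using Fin.lastCases with
    | last => simp [castSucc_last_mem_adjSet_snocPerm, last_notMem_adjSet]
    | cast i => simp [castSucc_mem_adjSet_snocPerm, (Fin.castSucc_lt_last i).ne]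

lemma adj_snocPerm_last {m : ℕ} (σ : Equiv.Perm (Fin (m + 1))) :
    adj (snocPerm (Fin.last (m + 1)) σ) = adj σ := by
  rw [← card_adjSet, adjSet_snocPerm, Finset.card_map, ← card_adjSet]
  congr 1
  ext a
  simp [(Fin.castSucc_lt_last _).ne]

lemma adj_snocPerm_castSucc {m : ℕ} (σ : Equiv.Perm (Fin (m + 1))) (b : Fin (m + 1)) :
    adj (snocPerm (σ b).castSucc σ) =
      if b ∈ adjSet σ then adj σ - 1 else if b = Fin.last m then adj σ + 1 else adj σ := by
  have hset : adjSet (snocPerm (σ b).castSucc σ) =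
      ((adjSet σ).erase b ∪ if b = Fin.last m then {b} else ∅).map Fin.castSuccEmb := by
    rw [adjSet_snocPerm]
    congr 1
    ext a
    split_ifs with hb <;> simp <;> grind
  rw [← card_adjSet, hset, Finset.card_map, ← card_adjSet]
  have hl := last_notMem_adjSet σ
  by_cases h1 : b ∈ adjSet σ
  · have h2 : b ≠ Fin.last m := fun h => hl (h ▸ h1)
    simp [h1, h2]
  · by_cases h2 : b = Fin.last m
    · rw [if_pos h2, if_neg h1, if_pos h2, Finset.erase_eq_of_notMem h1,
        Finset.card_union_of_disjoint (by simpa using h1), Finset.card_singleton]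
    · simp [h1, h2]

/-- The effect of appending one uniformly chosen entry: of the `m + 2` choices, `adj σ` destroy an
adjacency, one creates an adjacency, and the others keep their number. -/
lemma sum_adj_succ {m : ℕ} (g : ℕ → ℕ) :
    ∑ σ : Equiv.Perm (Fin (m + 2)), g (adj σ) =
      ∑ σ : Equiv.Perm (Fin (m + 1)),
        (adj σ * g (adj σ - 1) + g (adj σ + 1) + (m + 1 - adj σ) * g (adj σ)) := by
  rw [← (bijective_snocPerm (m + 1)).sum_comp (fun σ => g (adj σ)), Fintype.sum_prod_type_right]
  refine Finset.sum_congr rfl fun σ _ => ?_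
  rw [Fin.sum_univ_castSucc, adj_snocPerm_last,
    ← Equiv.sum_comp σ fun i => g (adj (snocPerm i.castSucc σ))]
  have hl := last_notMem_adjSet σ
  have hins : (insert (Fin.last m) (adjSet σ)).card = adj σ + 1 := by
    rw [Finset.card_insert_of_notMem hl, card_adjSet]
  have hle : adj σ + 1 ≤ m + 1 := by
    simpa [hins] using Finset.card_le_univ (insert (Fin.last m) (adjSet σ))
  rw [← Finset.sum_add_sum_compl (insert (Fin.last m) (adjSet σ)), Finset.sum_insert hl]
  have e1 : ∑ b ∈ adjSet σ, g (adj (snocPerm (σ b).castSucc σ)) = adj σ * g (adj σ - 1) := by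
    rw [Finset.sum_congr rfl (g := fun _ => g (adj σ - 1))
      fun b hb => by rw [adj_snocPerm_castSucc, if_pos hb]]
    simp [card_adjSet]
  have e2 : ∑ b ∈ (insert (Fin.last m) (adjSet σ))ᶜ, g (adj (snocPerm (σ b).castSucc σ)) =
      (m + 1 - (adj σ + 1)) * g (adj σ) := by
    rw [Finset.sum_congr rfl (g := fun _ => g (adj σ)) fun b hb => by
      simp only [Finset.mem_compl, Finset.mem_insert, not_or] at hb
      rw [adj_snocPerm_castSucc, if_neg hb.2, if_neg hb.1]]
    rw [Finset.sum_const, Finset.card_compl, hins, Fintype.card_fin, smul_eq_mul]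
  rw [e1, e2, adj_snocPerm_castSucc, if_neg hl, if_pos rfl]
  obtain ⟨c, hc⟩ := Nat.exists_eq_add_of_le hle
  rw [show m + 1 - (adj σ + 1) = c by lia, show m + 1 - adj σ = c + 1 by lia]
  ring

/-! ### The exact distribution -/

/-- The number of permutations of length `n` with exactly `k` adjacencies. -/
def adjCount (n k : ℕ) : ℕ := (Finset.univ.filter fun σ : Equiv.Perm (Fin n) => adj σ = k).card

lemma adjCount_eq_sum (n k : ℕ) :
    adjCount n k = ∑ σ : Equiv.Perm (Fin n), if adj σ = k then 1 else 0 := by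
  rw [adjCount, Finset.card_filter]

/-- The recursion in the length for `adjCount`. The middle sum is `adjCount (m + 1) (k - 1)` for
`0 < k` and zero for `k = 0`. -/
lemma adjCount_succ (m k : ℕ) :
    adjCount (m + 2) k = (k + 1) * adjCount (m + 1) (k + 1) +
      (∑ σ : Equiv.Perm (Fin (m + 1)), if adj σ + 1 = k then 1 else 0) +
      (m + 1 - k) * adjCount (m + 1) k := by
  rw [adjCount_eq_sum, sum_adj_succ fun x => if x = k then 1 else 0]
  simp only [adjCount_eq_sum, Finset.mul_sum, ← Finset.sum_add_distrib]
  refine Finset.sum_congr rfl fun σ _ => ?_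
  grind

/-- The recursion of the numbers `D r + D (r + 1)`, which count the permutations of length `r + 1`
without adjacencies. For `m = 0` the truncated `m - 1` is multiplied by zero. -/
lemma numDerangements_add_succ (m : ℕ) :
    numDerangements (m + 1) + numDerangements (m + 2) =
      m * (numDerangements (m - 1) + numDerangements (m - 1 + 1)) +
        (m + 1) * (numDerangements m + numDerangements (m + 1)) := by
  cases m with
  | zero => simp [numDerangements]
  | succ m =>
    rw [numDerangements_add_two (m + 1), numDerangements_add_two m]
    simp only [Nat.add_sub_cancel]

/-- The `k` adjacencies may be placed at any `k` of the `m` possible positions, and glueing them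
leaves a permutation of length `m + 1 - k` without adjacencies. -/
lemma adjCount_eq (m k : ℕ) :
    adjCount (m + 1) k =
      m.choose k * (numDerangements (m - k) + numDerangements (m - k + 1)) := by
  induction m generalizing k with
  | zero =>
    have h0 (σ : Equiv.Perm (Fin 1)) : adj σ = 0 := by
      rw [adj, Finset.card_eq_zero, Finset.filter_eq_empty_iff]
      rintro i - ⟨h, -⟩
      lia
    cases k <;> simp [adjCount, h0]
  | succ m ih =>
    rw [adjCount_succ, ih, ih]
    have hd := numDerangements_add_succ (m - k)
    have hc := Nat.choose_succ_right_eq m k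
    -- What remains of the recursion once Pascal's rule has absorbed the middle sum.
    have key : (k + 1) * (m.choose (k + 1) *
        (numDerangements (m - (k + 1)) + numDerangements (m - (k + 1) + 1))) +
        (m + 1 - k) * (m.choose k * (numDerangements (m - k) + numDerangements (m - k + 1))) =
        m.choose k * (numDerangements (m + 1 - k) + numDerangements (m + 1 - k + 1)) := by
      rcases Nat.lt_or_ge m k with h | h
      · simp [Nat.choose_eq_zero_of_lt h, Nat.choose_eq_zero_of_lt (h.trans k.lt_succ_self)]
      · rw [show m + 1 - k = m - k + 1 by lia, hd, show m - (k + 1) = m - k - 1 by lia,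
          ← mul_assoc, mul_comm (k + 1), hc]
        ring
    cases k with
    | zero => simpa using key
    | succ k =>
      have := ih k
      rw [adjCount_eq_sum] at this
      simp only [Nat.add_right_cancel_iff, this]
      rw [Nat.choose_succ_succ, Nat.succ_eq_add_one, add_mul (m.choose k), ← key, show m + 1 - (k + 1) = m - k by lia]
      ring

/-! ### The Poisson limit -/

open Topology

lemma tendsto_adjCount_div_factorial (k : ℕ) :
    Tendsto (fun n : ℕ => (adjCount n k : ℝ) / n.factorial) atTop
      (𝓝 (Real.exp (-1) / k.factorial)) := by
  rw [← tendsto_add_atTop_iff_nat (k + 1)]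
  -- With `n = m + k + 1` the probability is `D (m + 2) / (m + 2)! * (m + 2) / (m + k + 1) / k!`.
  have h1 := (tendsto_add_atTop_iff_nat 2).2 numDerangements_tendsto_inv_e
  have h2 : Tendsto (fun m : ℕ => ((2 : ℝ) + 1 * m) / ((k + 1 : ℝ) + 1 * m)) atTop (𝓝 (1 / 1)) :=
    tendsto_add_mul_div_add_mul_atTop_nhds _ _ _ one_ne_zero
  have h3 := (h1.mul h2).div_const (k.factorial : ℝ)
  rw [div_one, mul_one] at h3
  refine h3.congr fun m => ?_
  have hc : ((m + k).choose k : ℝ) * (k.factorial * m.factorial) = (m + k).factorial := by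
    rw [← mul_assoc]
    exact_mod_cast by simpa using Nat.choose_mul_factorial_mul_factorial (Nat.le_add_left k m)
  have hd : (numDerangements (m + 2) : ℝ) =
      (m + 1) * (numDerangements m + numDerangements (m + 1)) := by
    rw [numDerangements_add_two]; push_cast; ring
  rw [← add_assoc, adjCount_eq, Nat.add_sub_cancel, hd, Nat.factorial_succ (m + k),
    Nat.factorial_succ (m + 1), Nat.factorial_succ m]
  push_cast
  rw [← hc]
  have hch : ((m + k).choose k : ℝ) ≠ 0 := by
    exact_mod_cast (Nat.choose_pos (Nat.le_add_left k m)).ne'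
  have := m.factorial_ne_zero
  have := k.factorial_ne_zero
  field_simp
  ring

/-- Convergence of the point masses implies weak convergence for probability measures on a
countable discrete space. -/
lemma tendsto_probabilityMeasure_of_tendsto_singleton {α ι : Type*} [Countable α]
    [MeasurableSpace α] [TopologicalSpace α] [DiscreteTopology α] [OpensMeasurableSpace α]
    {l : Filter ι} [l.IsCountablyGenerated] {μ : ι → ProbabilityMeasure α}
    {ν : ProbabilityMeasure α} (h : ∀ a, Tendsto (fun i => μ i {a}) l (𝓝 (ν {a}))) :
    Tendsto μ l (𝓝 ν) := by
  refine IsPiSystem.tendsto_probabilityMeasure_of_tendsto_of_mem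
    (S := {s | s.Subsingleton}) ?_ ?_ ?_ ?_
  · intro s hs t _ _
    exact hs.anti Set.inter_subset_left
  · intro s _
    exact (isOpen_discrete s).measurableSet
  · intro u _ x hx
    exact ⟨{x}, Set.subsingleton_singleton, by simp, by simpa using hx⟩
  · intro s hs
    rcases Set.Subsingleton.eq_empty_or_singleton hs with rfl | ⟨a, rfl⟩
    · simpa using tendsto_const_nhds
    · exact h a

lemma uniformOn_adj_preimage_singleton (n k : ℕ) :
    uniformOn (Set.univ : Set (Equiv.Perm (Fin n))) (adj ⁻¹' {k}) =
      ENNReal.ofReal ((adjCount n k : ℝ) / n.factorial) := by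
  have hset : (adj ⁻¹' {k} : Set (Equiv.Perm (Fin n))) =
      ((Finset.univ.filter fun σ : Equiv.Perm (Fin n) => adj σ = k : Finset _) : Set _) := by
    ext σ; simp
  rw [uniformOn_univ, hset, Measure.count_apply_finset, Fintype.card_perm, Fintype.card_fin,
    ENNReal.ofReal_div_of_pos (by positivity), ENNReal.ofReal_natCast, ENNReal.ofReal_natCast,
    adjCount]

lemma tendstoInDistribution_adj_nat :
    TendstoInDistribution (fun (n : ℕ) (σ : Equiv.Perm (Fin n)) => adj σ) atTop (id : ℕ → ℕ)
      (fun n : ℕ => uniformOn (Set.univ : Set (Equiv.Perm (Fin n)))) (poissonMeasure 1) where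
  forall_aemeasurable _ := .of_discrete
  aemeasurable_limit := .of_discrete
  tendsto := by
    refine tendsto_probabilityMeasure_of_tendsto_singleton fun k => ?_
    rw [← ENNReal.tendsto_coe]
    have hlim := ENNReal.tendsto_ofReal (tendsto_adjCount_div_factorial k)
    have hpoi : ENNReal.ofReal (Real.exp (-1) / k.factorial) =
        (poissonMeasure 1).map id {k} := by
      simp [poissonMeasure_singleton]
    rw [hpoi] at hlim
    convert! hlim using 1
    · ext n
      rw [← uniformOn_adj_preimage_singleton,
        ← Measure.map_apply Measurable.of_discrete (measurableSet_singleton k)]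
      exact ProbabilityMeasure.ennreal_coeFn_eq_coeFn_toMeasure _ _
    · exact congrArg 𝓝 (ProbabilityMeasure.ennreal_coeFn_eq_coeFn_toMeasure _ _)

/-- If `σ` is uniformly distributed on the permutations of length `n`, then `adj σ` (a real random
variable) converges in distribution, as `n → ∞`, to any random variable `Z` whose law is the
Poisson distribution with mean `1`. -/
theorem mainTheorem8 {Ω : Type*} [MeasurableSpace Ω] (P : Measure Ω) [IsProbabilityMeasure P]
    (Z : Ω → ℝ) (hZ : HasLaw Z ((poissonMeasure 1).map (Nat.cast : ℕ → ℝ)) P) :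
    TendstoInDistribution
      (fun (n : ℕ) (σ : Equiv.Perm (Fin n)) => (adj σ : ℝ)) atTop Z
      (fun n : ℕ => uniformOn (Set.univ : Set (Equiv.Perm (Fin n)))) P := by
  have h := tendstoInDistribution_adj_nat.continuous_comp
    (continuous_of_discreteTopology (f := (Nat.cast : ℕ → ℝ)))
  refine ⟨h.forall_aemeasurable, hZ.aemeasurable, ?_⟩
  convert! h.tendsto using 2
  exact congrArg 𝓝 (Subtype.ext hZ.map_eq)
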